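/- **Theorem (well-definedness of the kernel mean embedding in RKHMs).** Let $X$ be a locally compact Hausdorff space with its Borel $\sigma$-algebra, understood as the $\sigma$-algebra generated by the compact subsets of $X$. Let $A$ be a von Neumann algebra acting on a Hilbert space $W$ (a unital $C^*$-algebra with a faithful unital $*$-representation on $W$ whose image equals its double commutant). Let $k:X\times X\to A$ be an $A$-valued positive definite kernel, i.e. $k(x,y)=k(y,x)^*$ and $\sum_{i,j=1}^n c_i^*k(x_i,x_j)c_j\ge 0$ for all $n$, $x_i\in X$, $c_i\in A$. Assume that $k$ is a $c_0$-kernel: $k$ is bounded, and for each $x\in X$ the function $\phi(x)=k(\cdot,x)$ is continuous and vanishes at infinity. Let $M_k$ be the reproducing kernel Hilbert $A$-module of $k$, i.e. the completion of the right $A$-module of finite sums $\sum_i\phi(x_i)c_i$ for the $A$-valued inner product $\langle\sum_i\phi(x_i)c_i,\sum_j\phi(y_j)d_j\rangle=\sum_{i,j}c_i^*k(x_i,y_j)d_j$ and the norm $\|u\|=\|\langle u,u\rangle\|_A^{1/2}$. It is regarded as a space of functions $X\to A$ through $v(x)=\langle\phi(x),v\rangle$. Assume that $M_k$ is a von Neumann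 $A$-module: regarded as a set of bounded operators $w\mapsto v\otimes w$ from $W$ to the interior tensor product $M_k\otimes_A W$ (the Hilbert space completion of $M_k\otimes W$ for $\langle v\otimes w,u\otimes h\rangle=\langle w,\langle v,u\rangle h\rangle_W$), it is closed in the strong operator topology. Let $\mathcal D(X,A)$ be the set of $A$-valued finite regular Borel measures: countably additive $\mu$ with values in $A$, of finite total variation $|\mu|(X)=\sup\sum_i\|\mu(E_i)\|$ (over finite measurable partitions of $X$), such that for every measurable $E$ and $\varepsilon>0$ there are a compact $K\subseteq E$ and an open $G\supseteq E$ with $\|\mu(F)\|\le\varepsilon$ for all measurable $F\subseteq G\setminus K$. Put $\mu^*(E)=\mu(E)^*$. The integrals $\int u\,d\mu$ and $\int d\mu\,u$ of an $A$-valued function $u$ that is Bochner integrable with respect to $|\mu|$ are the extensions by $L^1(|\mu|)$-limits of $\sum_i c_i\mu(E_i)$ and $\sum_i\mu(E_i)c_i$ for step functions $u=\sum_i c_i\chi_{E_i}$. Then the kernel mean embedding $\Phi(\mu)=\int_X\phi(x)\,d\mu(x)$, i.e. the function $\Phi(\mu)(y)=\int_X k(y,x)\,d\mu(x)$, is a well-defined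 map $\Phi:\mathcal D(X,A)\to M_k$: for every $\mu\in\mathcal D(X,A)$ these integrals exist and $\Phi(\mu)\in M_k$. Moreover, for every $\mu\in\mathcal D(X,A)$ and $v\in M_k$, the function $v$ is integrable with respect to $\mu^*$ and $$\langle\Phi(\mu),v\rangle_{M_k}=\int_{x\in X}d\mu^*(x)\,v(x).$$ Consequently, for all $\mu,\nu\in\mathcal D(X,A)$, $$\langle\Phi(\mu),\Phi(\nu)\rangle_{M_k}=\int_{x\in X}d\mu^*(x)\left(\int_{y\in X}k(x,y)\,d\nu(y)\right),$$ and the integrals on the right exist. -/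

import Mathlib

open scoped TensorProduct ComplexOrder InnerProductSpace

noncomputable section

/-- A (right) Hilbert `A`-module: a complex normed space `M` with a right action of the C*-algebra
`A` (written as a module over `Aᵐᵒᵖ`) and an `A`-valued inner product, linear in the second
variable, whose induced norm `‖⟨u, u⟩‖ ^ (1 / 2)` is the norm of `M` and is complete. -/
class HilbertCStarModule (A M : Type*) [CStarAlgebra A] [PartialOrder A]
    [NormedAddCommGroup M] [NormedSpace ℂ M] [Module Aᵐᵒᵖ M] extends Inner A M where
  inner_add_right (u v w : M) : inner u (v + w) = inner u v + inner u w
  inner_smul_right (u v : M) (z : ℂ) : inner u (z • v) = z • inner u v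
  inner_op_smul_right (u v : M) (c : A) : inner u (MulOpposite.op c • v) = inner u v * c
  star_inner (u v : M) : star (inner u v) = inner v u
  inner_self_nonneg (u : M) : 0 ≤ inner u u
  inner_self_eq_zero (u : M) : inner u u = 0 → u = 0
  norm_eq (u : M) : ‖u‖ = √‖inner u u‖
  complete : CompleteSpace M

namespace HilbertCStarModule

variable {A M : Type*} [CStarAlgebra A] [PartialOrder A]
  [NormedAddCommGroup M] [NormedSpace ℂ M] [Module Aᵐᵒᵖ M] [HilbertCStarModule A M]

theorem inner_add_left (u v w : M) : inner A (u + v) w = inner A u w + inner A v w := by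
  rw [← star_inner, inner_add_right, star_add, star_inner, star_inner]

theorem inner_smul_left (u v : M) (z : ℂ) :
    inner A (z • u) v = (starRingEnd ℂ) z • inner A u v := by
  rw [← star_inner, inner_smul_right, star_smul, star_inner]; rfl

theorem inner_op_smul_left (u v : M) (c : A) :
    inner A (MulOpposite.op c • u) v = star c * inner A u v := by
  rw [← star_inner, inner_op_smul_right, star_mul, star_inner]

theorem inner_sum_right {ι : Type*} (s : Finset ι) (u : M) (v : ι → M) :
    inner A u (∑ i ∈ s, v i) = ∑ i ∈ s, inner A u (v i) :=
  map_sum (AddMonoidHom.mk' (fun v => inner A u v) (inner_add_right u)) v s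

theorem inner_sum_left {ι : Type*} (s : Finset ι) (u : M) (v : ι → M) :
    inner A (∑ i ∈ s, v i) u = ∑ i ∈ s, inner A (v i) u :=
  map_sum (AddMonoidHom.mk' (fun v => inner A v u) (fun a b => inner_add_left a b u)) v s

/-- Decomposition of a self-adjoint element into a difference of orthogonal positive elements. -/
theorem exists_decomp {B : Type*} [CStarAlgebra B] [PartialOrder B] [StarOrderedRing B] (Q : B)
    (hQ : IsSelfAdjoint Q) :
    ∃ P R S T : B, Q = P - R ∧ P * R = 0 ∧ P = star S * S ∧ star R = R ∧ R = star T * T := by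
  have hR0 : 0 ≤ Q⁻ := CFC.negPart_nonneg Q
  obtain ⟨T, hT⟩ := CStarAlgebra.nonneg_iff_eq_star_mul_self.mp hR0
  obtain ⟨S, hS⟩ := CStarAlgebra.nonneg_iff_eq_star_mul_self.mp (CFC.posPart_nonneg Q)
  exact ⟨Q⁺, Q⁻, S, T, (CFC.posPart_sub_negPart Q hQ).symm, CFC.posPart_mul_negPart Q,
    hS, (IsSelfAdjoint.of_nonneg hR0).star_eq, hT⟩

/-- The Gram matrix of vectors of a Hilbert C*-module is a positive matrix over `A`. -/
theorem exists_gram_eq [StarOrderedRing A] {n : ℕ} (v : Fin n → M) :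
    ∃ S : CStarMatrix (Fin n) (Fin n) A,
      CStarMatrix.ofMatrix (Matrix.of fun i j => inner A (v i) (v j)) = star S * S := by
  set Q : CStarMatrix (Fin n) (Fin n) A :=
    CStarMatrix.ofMatrix (Matrix.of fun i j => inner A (v i) (v j)) with hQ
  have hQe : ∀ i j, Q i j = inner A (v i) (v j) := fun i j => rfl
  have hsa : IsSelfAdjoint Q := by
    rw [IsSelfAdjoint]
    ext i j
    rw [CStarMatrix.star_apply, hQe, hQe, star_inner]
  obtain ⟨P, R, S, T, h1, h2, hP, hRsa, hT⟩ := exists_decomp Q hsa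
  have hRQR : star R * Q * R = - (star (T * R) * (T * R)) := by
    rw [h1, hRsa, mul_assoc, sub_mul, h2, zero_sub, mul_neg, star_mul, hRsa]
    congr 1
    conv_lhs => rw [show R * (R * R) = R * ((star T * T) * R) by rw [← hT]]
    simp only [mul_assoc]
  have hdiag : ∀ l, 0 ≤ (star R * Q * R) l l := by
    intro l
    have : (star R * Q * R) l l =
        inner A (∑ i, MulOpposite.op (R i l) • v i) (∑ i, MulOpposite.op (R i l) • v i) := by
      rw [inner_sum_right]
      simp only [CStarMatrix.mul_apply, CStarMatrix.star_apply, hQe, inner_sum_left,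
        inner_op_smul_right, inner_op_smul_left]
    rw [this]
    exact inner_self_nonneg _
  have hTR : T * R = 0 := by
    ext k l
    have h3 : (star (T * R) * (T * R)) l l = ∑ k, star ((T * R) k l) * (T * R) k l := by
      simp only [CStarMatrix.mul_apply (M := star (T * R)), CStarMatrix.star_apply]
    have h4 : ∑ k, star ((T * R) k l) * (T * R) k l = 0 := by
      apply le_antisymm
      · have := hdiag l
        rw [hRQR, CStarMatrix.neg_apply, h3] at this
        exact neg_nonneg.mp this
      · exact Finset.sum_nonneg fun k _ => star_mul_self_nonneg _
    have h5 := (Finset.sum_eq_zero_iff_of_nonneg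
      (fun k _ => star_mul_self_nonneg ((T * R) k l))).mp h4 k (Finset.mem_univ k)
    simpa using (CStarRing.star_mul_self_eq_zero_iff _).mp h5
  have hRR : R * R = 0 := by
    conv_lhs => rw [show R * R = (star T * T) * R by rw [← hT]]
    rw [mul_assoc, hTR, mul_zero]
  have hRz : R = 0 := by
    rw [← CStarRing.star_mul_self_eq_zero_iff, hRsa, hRR]
  rw [h1, hRz, sub_zero]
  exact ⟨S, hP⟩

/-- Positivity of the form that defines the interior tensor product. -/
theorem sum_inner_nonneg [StarOrderedRing A] {W : Type*} [NormedAddCommGroup W]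
    [InnerProductSpace ℂ W] [CompleteSpace W] (π : A →⋆ₐ[ℂ] (W →L[ℂ] W)) {n : ℕ} (v : Fin n → M) (w : Fin n → W) :
    0 ≤ RCLike.re (∑ i, ∑ j, ⟪w i, π (inner A (v i) (v j)) (w j)⟫_ℂ) := by
  obtain ⟨S, hS⟩ := exists_gram_eq (A := A) v
  have hS' : ∀ i j, inner A (v i) (v j) = ∑ k, star (S k i) * S k j := by
    intro i j
    have := congrFun (congrFun hS i) j
    simp only [CStarMatrix.mul_apply, CStarMatrix.star_apply] at this
    exact this
  have : ∑ i, ∑ j, ⟪w i, π (inner A (v i) (v j)) (w j)⟫_ℂ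
      = ∑ k, ⟪∑ i, π (S k i) (w i), ∑ j, π (S k j) (w j)⟫_ℂ := by
    simp only [hS', map_sum, _root_.sum_apply, inner_sum, sum_inner, map_mul,
      map_star, ContinuousLinearMap.star_eq_adjoint, _root_.mul_apply_eq_comp,
      ContinuousLinearMap.adjoint_inner_right]
    rw [Finset.sum_congr rfl fun i _ => Finset.sum_comm, Finset.sum_comm]
    exact Finset.sum_congr rfl fun k _ => Finset.sum_comm
  rw [this, map_sum]
  exact Finset.sum_nonneg fun k _ => _root_.inner_self_nonneg (𝕜 := ℂ)

end HilbertCStarModule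

/-! ### The interior tensor product and von Neumann modules -/

section InteriorTensor

variable {A W : Type*} [CStarAlgebra A] [PartialOrder A] [StarOrderedRing A]
  [NormedAddCommGroup W] [InnerProductSpace ℂ W] [CompleteSpace W]
  (π : A →⋆ₐ[ℂ] (W →L[ℂ] W))
  (M : Type*) [NormedAddCommGroup M] [NormedSpace ℂ M] [Module Aᵐᵒᵖ M] [HilbertCStarModule A M]

/-- The algebraic tensor product `M ⊗ W`, carrying the pre-inner product
`⟨v ⊗ w, u ⊗ h⟩ = ⟨w, π ⟨v, u⟩ h⟩`. -/
def InteriorTensorPre (_π : A →⋆ₐ[ℂ] (W →L[ℂ] W)) (M : Type*) [NormedAddCommGroup M]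
    [NormedSpace ℂ M] : Type _ := M ⊗[ℂ] W

namespace InteriorTensorPre

instance : AddCommGroup (InteriorTensorPre π M) := inferInstanceAs (AddCommGroup (M ⊗[ℂ] W))

instance : Module ℂ (InteriorTensorPre π M) := inferInstanceAs (Module ℂ (M ⊗[ℂ] W))

/-- The sesquilinear form determined by `⟨v ⊗ w, u ⊗ h⟩ = ⟨w, π ⟨v, u⟩ h⟩`. -/
def form : M ⊗[ℂ] W →ₗ⋆[ℂ] M ⊗[ℂ] W →ₗ[ℂ] ℂ :=
  TensorProduct.lift <| LinearMap.mk₂'ₛₗ (starRingEnd ℂ) (starRingEnd ℂ)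
    (fun (v : M) (w : W) => TensorProduct.lift <| LinearMap.mk₂ ℂ
      (fun (u : M) (h : W) => ⟪w, π (inner A v u) h⟫_ℂ)
      (fun u u' h => by
        rw [HilbertCStarModule.inner_add_right, map_add, add_apply, inner_add_right])
      (fun z u h => by
        rw [HilbertCStarModule.inner_smul_right, map_smul, smul_apply, inner_smul_right,
          smul_eq_mul])
      (fun u h h' => by rw [map_add, inner_add_right])
      (fun z u h => by rw [map_smul, inner_smul_right, smul_eq_mul]))
    (fun v v' w => TensorProduct.ext' fun u h => by
      simp [HilbertCStarModule.inner_add_left])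
    (fun z v w => TensorProduct.ext' fun u h => by
      simp [HilbertCStarModule.inner_smul_left])
    (fun v w w' => TensorProduct.ext' fun u h => by simp)
    (fun z v w => TensorProduct.ext' fun u h => by simp [mul_comm])

theorem form_tmul (v u : M) (w h : W) :
    form π M (v ⊗ₜ w) (u ⊗ₜ h) = ⟪w, π (inner A v u) h⟫_ℂ := rfl

theorem conj_form (s t : M ⊗[ℂ] W) : (starRingEnd ℂ) (form π M t s) = form π M s t := by
  induction s with
  | zero => simp
  | add s s' hs hs' => simp only [map_add, LinearMap.add_apply, hs, hs']
  | tmul v w =>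
    induction t with
    | zero => simp
    | add t t' ht ht' => simp only [map_add, LinearMap.add_apply, ht, ht']
    | tmul u h =>
      rw [form_tmul, form_tmul, inner_conj_symm, ← HilbertCStarModule.star_inner u v, map_star,
        ContinuousLinearMap.star_eq_adjoint, ContinuousLinearMap.adjoint_inner_right]

theorem form_self_nonneg (s : M ⊗[ℂ] W) : 0 ≤ RCLike.re (form π M s s) := by
  obtain ⟨n, v, w, rfl⟩ := TensorProduct.exists_sum_tmul_eq s
  simp only [map_sum, LinearMap.sum_apply, form_tmul]
  have := HilbertCStarModule.sum_inner_nonneg π v w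
  rw [Finset.sum_comm] at this
  simpa only [map_sum] using this

instance core : PreInnerProductSpace.Core ℂ (InteriorTensorPre π M) where
  inner s t := form π M s t
  conj_inner_symm s t := conj_form π M s t
  re_inner_nonneg s := form_self_nonneg π M s
  add_left s t r := LinearMap.map_add₂ (form π M) s t r
  smul_left s t z := LinearMap.map_smulₛₗ₂ (form π M) z s t

instance : SeminormedAddCommGroup (InteriorTensorPre π M) :=
  InnerProductSpace.Core.toSeminormedAddCommGroup (𝕜 := ℂ)

instance : InnerProductSpace ℂ (InteriorTensorPre π M) :=
  InnerProductSpace.ofCore (core π M)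

variable {M} in
/-- The elementary tensors `v ⊗ w`, as a linear function of `w`. -/
def tmul (v : M) : W →ₗ[ℂ] InteriorTensorPre π M := TensorProduct.mk ℂ M W v

instance : UniformContinuousConstSMul ℂ (InteriorTensorPre π M) :=
  NormedSpace.toIsBoundedSMul.toUniformContinuousConstSMul

end InteriorTensorPre

/-- The interior tensor product `M ⊗_A W`: the Hilbert space obtained by completing `M ⊗ W`. -/
abbrev InteriorTensor : Type _ := UniformSpace.Completion (InteriorTensorPre π M)

variable {M}

/-- The elementary tensor `v ⊗ w` in `M ⊗_A W`. -/
def InteriorTensor.tmul (v : M) (w : W) : InteriorTensor π M :=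
  UniformSpace.Completion.coe' (InteriorTensorPre.tmul π v w)

theorem InteriorTensor.inner_tmul (v u : M) (w h : W) :
    ⟪tmul π v w, tmul π u h⟫_ℂ = ⟪w, π (inner A v u) h⟫_ℂ :=
  UniformSpace.Completion.inner_coe (𝕜 := ℂ) (E := InteriorTensorPre π M) _ _

/-- A vector `v` of `M`, regarded as the bounded operator `w ↦ v ⊗ w` from `W` to `M ⊗_A W`. -/
def InteriorTensor.toOperator (v : M) : W →L[ℂ] InteriorTensor π M :=
  LinearMap.mkContinuous
    { toFun := fun w => tmul π v w
      map_add' := fun w w' => by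
        rw [tmul, map_add, UniformSpace.Completion.coe_add]; rfl
      map_smul' := fun z w => by
        rw [tmul, map_smul, UniformSpace.Completion.coe_smul]; rfl }
    ‖v‖ (fun w => by
      refine le_of_sq_le_sq ?_ (by positivity)
      change ‖tmul π v w‖ ^ 2 ≤ _
      rw [← inner_self_eq_norm_sq (𝕜 := ℂ), inner_tmul, mul_pow, HilbertCStarModule.norm_eq (A := A),
        Real.sq_sqrt (norm_nonneg _)]
      calc RCLike.re ⟪w, π (inner A v v) w⟫_ℂ ≤ ‖⟪w, π (inner A v v) w⟫_ℂ‖ := RCLike.re_le_norm _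
        _ ≤ ‖w‖ * ‖π (inner A v v) w‖ := norm_inner_le_norm _ _
        _ ≤ ‖w‖ * (‖inner A v v‖ * ‖w‖) := by
          gcongr
          exact ((π (inner A v v)).le_opNorm w).trans
            (by gcongr; exact NonUnitalStarAlgHom.norm_apply_le π _)
        _ = ‖inner A v v‖ * ‖w‖ ^ 2 := by ring)

theorem InteriorTensor.toOperator_apply (v : M) (w : W) : toOperator π v w = tmul π v w := rfl

variable (M)

/-- The Hilbert `A`-module `M` is a von Neumann `A`-module (with respect to the representation `π`
of `A` on `W`): as a set of operators from `W` to `M ⊗_A W`, it is closed in the strong operator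
topology, that is, the topology of pointwise convergence. -/
def IsVonNeumannModule : Prop :=
  IsClosed {T : W →Lₚₜ[ℂ] InteriorTensor π M |
    ∃ v : M, ∀ w : W, T w = InteriorTensor.toOperator π v w}

end InteriorTensor

/-- `π` is a faithful representation of `A` whose image is a von Neumann algebra on `W`, i.e. is
equal to its double commutant. -/
def IsVonNeumannRepresentation {A W : Type*} [CStarAlgebra A] [NormedAddCommGroup W]
    [InnerProductSpace ℂ W] [CompleteSpace W] (π : A →⋆ₐ[ℂ] (W →L[ℂ] W)) : Prop :=
  Function.Injective π ∧ ∃ S : VonNeumannAlgebra W, (S : Set (W →L[ℂ] W)) = Set.range π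

/-! ### Positive definite kernels and the reproducing kernel Hilbert module -/

/-- An `A`-valued positive definite kernel on `X`. -/
structure PDKernel (X A : Type*) [CStarAlgebra A] [PartialOrder A] where
  toFun : X → X → A
  star_apply : ∀ x y, star (toFun y x) = toFun x y
  nonneg : ∀ (n : ℕ) (x : Fin n → X) (c : Fin n → A),
    0 ≤ ∑ i, ∑ j, star (c i) * toFun (x i) (x j) * c j

instance (X A : Type*) [CStarAlgebra A] [PartialOrder A] :
    CoeFun (PDKernel X A) fun _ => X → X → A := ⟨PDKernel.toFun⟩

/-- `k` is a `c₀`-kernel: it is bounded, and `k(·, x)` is continuous and vanishes at infinity for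
every `x`. -/
structure PDKernel.IsC0 {X A : Type*} [TopologicalSpace X] [CStarAlgebra A] [PartialOrder A]
    (k : PDKernel X A) : Prop where
  bounded : ∃ C : ℝ, ∀ x y, ‖k x y‖ ≤ C
  continuous : ∀ x, Continuous fun y => k y x
  zero_at_infty : ∀ x, Filter.Tendsto (fun y => k y x) (Filter.cocompact X) (nhds 0)

section RKHM

variable {X A : Type*} [CStarAlgebra A] [PartialOrder A]

/-- Formal combinations `∑ φ(x) c` with finitely many nonzero coefficients `c : A`; the combination
`f : X →₀ A` stands for `∑ φ(x) f(x)`. -/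
def PreRKHM (_k : PDKernel X A) : Type _ := X →₀ A

namespace PreRKHM

variable (k : PDKernel X A)

instance : AddCommGroup (PreRKHM k) := inferInstanceAs (AddCommGroup (X →₀ A))

instance : Module ℂ (PreRKHM k) := inferInstanceAs (Module ℂ (X →₀ A))

/-- The right action `(∑ φ(x) c) d = ∑ φ(x) (c d)`. -/
instance : Module Aᵐᵒᵖ (PreRKHM k) := inferInstanceAs (Module Aᵐᵒᵖ (X →₀ A))

/-- The `A`-valued form `⟨∑ φ(x) c, ∑ φ(y) d⟩ = ∑ ∑ c* k(x, y) d`. -/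
def form (f g : X →₀ A) : A := f.sum fun x c => g.sum fun y d => star c * k x y * d

theorem form_add_right (f g h : X →₀ A) : form k f (g + h) = form k f g + form k f h := by
  unfold form
  rw [← Finsupp.sum_add]
  refine Finsupp.sum_congr fun x _ => ?_
  exact Finsupp.sum_add_index' (by simp) (fun y c d => by rw [mul_add])

theorem star_form (f g : X →₀ A) : star (form k f g) = form k g f := by
  unfold form Finsupp.sum
  simp only [star_sum, star_mul, star_star, k.star_apply, mul_assoc]
  exact Finset.sum_comm

theorem form_op_smul_right (f g : X →₀ A) (c : A) :
    form k f (MulOpposite.op c • g) = form k f g * c := by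
  unfold form
  rw [Finsupp.sum_mul]
  refine Finsupp.sum_congr fun x _ => ?_
  rw [Finsupp.sum_smul_index' (by simp), Finsupp.sum_mul]
  simp [mul_assoc]

theorem form_smul_right (f g : X →₀ A) (z : ℂ) : form k f (z • g) = z • form k f g := by
  unfold form
  rw [Finsupp.smul_sum]
  refine Finsupp.sum_congr fun x _ => ?_
  rw [Finsupp.sum_smul_index' (by simp), Finsupp.smul_sum]
  simp

theorem form_self_nonneg (f : X →₀ A) : 0 ≤ form k f f := by
  have h := k.nonneg f.support.card (fun i => (f.support.equivFin.symm i : X))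
    (fun i => f (f.support.equivFin.symm i : X))
  convert h using 1
  unfold form Finsupp.sum
  rw [← Finset.sum_coe_sort, ← Equiv.sum_comp f.support.equivFin.symm]
  refine Finset.sum_congr rfl fun i _ => ?_
  exact ((Finset.sum_coe_sort f.support fun y => star (f (f.support.equivFin.symm i)) *
    k (f.support.equivFin.symm i) y * f y).symm).trans (Equiv.sum_comp f.support.equivFin.symm _).symm

theorem form_single (f : X →₀ A) (x : X) (c : A) :
    form k (Finsupp.single x c) f = star c * f.sum fun y d => k x y * d := by
  unfold form
  rw [Finsupp.sum_single_index (by simp), Finsupp.mul_sum]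
  simp [mul_assoc]

theorem form_add_left (f g h : X →₀ A) : form k (f + g) h = form k f h + form k g h := by
  rw [← star_form, form_add_right, star_add, star_form, star_form]

theorem form_op_smul_left (f g : X →₀ A) (c : A) :
    form k (MulOpposite.op c • f) g = star c * form k f g := by
  rw [← star_form, form_op_smul_right, star_mul, star_form]

theorem form_smul_left (f g : X →₀ A) (z : ℂ) :
    form k (z • f) g = (starRingEnd ℂ) z • form k f g := by
  rw [← star_form, form_smul_right, star_smul, star_form]; rfl

theorem form_neg_right (f g : X →₀ A) : form k f (-g) = - form k f g :=
  map_neg (AddMonoidHom.mk' (form k f) (form_add_right k f)) g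

theorem form_neg_left (f g : X →₀ A) : form k (-f) g = - form k f g :=
  map_neg (AddMonoidHom.mk' (fun f => form k f g) (fun a b => form_add_left k a b g)) f

theorem form_neg_neg (f : X →₀ A) : form k (-f) (-f) = form k f f := by
  rw [form_neg_left, form_neg_right, neg_neg]

theorem form_op_smul_self (f : X →₀ A) (c : A) :
    form k (MulOpposite.op c • f) (MulOpposite.op c • f) = star c * form k f f * c := by
  rw [form_op_smul_left, form_op_smul_right, mul_assoc]

theorem sqrt_form_smul (f : X →₀ A) (z : ℂ) :
    √‖form k (z • f) (z • f)‖ = ‖z‖ * √‖form k f f‖ := by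
  rw [form_smul_left, form_smul_right, norm_smul, norm_smul, RCLike.norm_conj, ← mul_assoc,
    Real.sqrt_mul (by positivity), Real.sqrt_mul_self (norm_nonneg _)]

instance : Inner A (PreRKHM k) where
  inner f g := form k f g

variable [StarOrderedRing A]

theorem norm_form_sq_le (f g : X →₀ A) :
    ‖form k f g‖ ^ 2 ≤ ‖form k f f‖ * ‖form k g g‖ := by
  have key : ∀ t : ℝ, ‖form k f f‖ < t → ‖form k f g‖ ^ 2 ≤ t * ‖form k g g‖ := by
    intro t ht
    have ht0 : 0 < t := (norm_nonneg _).trans_lt ht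
    set a := form k f g with ha
    have ha' : form k g f = star a := (star_form k f g).symm
    have h1 := form_self_nonneg k (MulOpposite.op a • f + (-((t : ℂ) • g)))
    have h2 : form k (MulOpposite.op a • f + (-((t : ℂ) • g)))
        (MulOpposite.op a • f + (-((t : ℂ) • g))) =
        star a * form k f f * a - (2 * t) • (star a * a) + (t ^ 2) • form k g g := by
      simp only [form_add_left, form_add_right, form_neg_left, form_neg_right,
        form_op_smul_left, form_op_smul_right, form_smul_left, form_smul_right, ← ha, ha',
        Complex.conj_ofReal]
      simp only [Complex.coe_smul, add_mul, neg_mul, smul_mul_assoc]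
      module
    have h3 : star a * form k f f * a ≤ t • (star a * a) := by
      have h4 : form k f f ≤ algebraMap ℝ A t :=
        (IsSelfAdjoint.le_algebraMap_norm_self (IsSelfAdjoint.of_nonneg
          (form_self_nonneg k f))).trans (algebraMap_mono A ht.le)
      have h5 := star_left_conjugate_le_conjugate h4 a
      rwa [Algebra.algebraMap_eq_smul_one, mul_smul_comm, mul_one, smul_mul_assoc] at h5
    have h6 : t • (star a * a) ≤ t • (t • form k g g) := by
      rw [h2] at h1
      have h7 : star a * form k f f * a - (2 * t) • (star a * a) + (t ^ 2) • form k g g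
          ≤ t • (star a * a) - (2 * t) • (star a * a) + (t ^ 2) • form k g g := by gcongr
      have h8 := h1.trans h7
      have h9 : t • (star a * a) - (2 * t) • (star a * a) + (t ^ 2) • form k g g
        = t • (t • form k g g) - t • (star a * a) := by module
      rw [h9] at h8
      exact sub_nonneg.mp h8
    have h10 := CStarAlgebra.norm_le_norm_of_nonneg_of_le
      (smul_nonneg ht0.le (star_mul_self_nonneg a)) h6
    rw [norm_smul, norm_smul, norm_smul, CStarRing.norm_star_mul_self, Real.norm_eq_abs,
      abs_of_pos ht0] at h10
    have := le_of_mul_le_mul_left h10 ht0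
    rwa [pow_two]
  refine le_of_forall_pos_le_add fun ε hε => ?_
  have hc : 0 < ‖form k g g‖ + 1 := by positivity
  refine (key (‖form k f f‖ + ε / (‖form k g g‖ + 1)) (by simp; positivity)).trans ?_
  rw [add_mul]
  gcongr
  rw [div_mul_eq_mul_div, div_le_iff₀ hc]
  nlinarith [norm_nonneg (form k g g)]

theorem norm_form_le (f g : X →₀ A) :
    ‖form k f g‖ ≤ √‖form k f f‖ * √‖form k g g‖ := by
  rw [← Real.sqrt_mul (norm_nonneg _)]
  exact Real.le_sqrt_of_sq_le (norm_form_sq_le k f g)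

theorem sqrt_form_add_le (f g : X →₀ A) :
    √‖form k (f + g) (f + g)‖ ≤ √‖form k f f‖ + √‖form k g g‖ := by
  refine Real.sqrt_le_iff.mpr ⟨by positivity, ?_⟩
  have h1 : form k (f + g) (f + g) = form k f f + form k f g + (form k g f + form k g g) := by
    rw [form_add_left, form_add_right, form_add_right]
  have h2 := Real.sq_sqrt (norm_nonneg (form k f f))
  have h3 := Real.sq_sqrt (norm_nonneg (form k g g))
  have h4 := norm_form_le k f g
  have h5 := norm_form_le k g f
  rw [h1]
  have h6 := norm_add_le (form k f f + form k f g) (form k g f + form k g g)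
  have h7 := norm_add_le (form k f f) (form k f g)
  have h8 := norm_add_le (form k g f) (form k g g)
  nlinarith

/-- The seminorm `‖⟨f, f⟩‖ ^ (1 / 2)`. -/
instance : SeminormedAddCommGroup (PreRKHM k) :=
  AddGroupSeminorm.toSeminormedAddCommGroup
    { toFun := fun f => √‖form k f f‖
      map_zero' := by
        have : form k 0 0 = 0 := Finsupp.sum_zero_index
        exact (congrArg (fun a => √‖a‖) this).trans (by simp)
      add_le' := sqrt_form_add_le k
      neg' := fun f => congrArg (fun a => √‖a‖) (form_neg_neg k f) }

theorem norm_def (f : PreRKHM k) : ‖f‖ = √‖form k f f‖ := rfl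

instance : NormedSpace ℂ (PreRKHM k) where
  norm_smul_le z f := (sqrt_form_smul k f z).le

instance : UniformContinuousConstSMul ℂ (PreRKHM k) :=
  NormedSpace.toIsBoundedSMul.toUniformContinuousConstSMul

theorem norm_op_smul_le (f : PreRKHM k) (c : Aᵐᵒᵖ) : ‖c • f‖ ≤ ‖c‖ * ‖f‖ := by
  have h : form k (c • f : PreRKHM k) (c • f : PreRKHM k)
      = star c.unop * form k f f * c.unop := form_op_smul_self k f c.unop
  rw [norm_def, norm_def, h]
  refine Real.sqrt_le_iff.mpr ⟨by positivity, ?_⟩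
  rw [mul_pow, Real.sq_sqrt (norm_nonneg _)]
  calc ‖star c.unop * form k f f * c.unop‖ ≤ ‖star c.unop‖ * ‖form k f f‖ * ‖c.unop‖ :=
        (norm_mul_le _ _).trans (by gcongr; exact norm_mul_le _ _)
    _ = ‖c‖ ^ 2 * ‖form k f f‖ := by rw [norm_star, MulOpposite.norm_unop]; ring

instance : UniformContinuousConstSMul Aᵐᵒᵖ (PreRKHM k) where
  uniformContinuous_const_smul c :=
    (LipschitzWith.of_dist_le_mul (K := ‖c‖₊) fun f g => by
      rw [dist_eq_norm, dist_eq_norm, ← smul_sub]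
      exact norm_op_smul_le k _ c).uniformContinuous

theorem continuous_inner : Continuous fun p : PreRKHM k × PreRKHM k => inner A p.1 p.2 := by
  let B : PreRKHM k →ₗ⋆[ℂ] PreRKHM k →ₗ[ℂ] A :=
    LinearMap.mk₂'ₛₗ (starRingEnd ℂ) (RingHom.id ℂ) (fun f g => inner A f g)
      (fun f g h => form_add_left k f g h) (fun z f g => form_smul_left k f g z)
      (fun f g h => form_add_right k f g h) (fun z f g => form_smul_right k f g z)
  let B' : PreRKHM k →L⋆[ℂ] PreRKHM k →L[ℂ] A :=
    LinearMap.mkContinuous₂ B 1 fun f g => by rw [one_mul]; exact norm_form_le k f g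
  exact (B'.continuous.comp continuous_fst).clm_apply continuous_snd

end PreRKHM

variable [StarOrderedRing A]

/-- The reproducing kernel Hilbert module `M_k`: the completion of the module of finite
combinations `∑ φ(x) c` with respect to the norm of the inner product determined by `k` (passing to
the completion identifies combinations whose difference has norm zero). -/
abbrev RKHM (k : PDKernel X A) : Type _ := UniformSpace.Completion (PreRKHM k)

namespace RKHM

variable (k : PDKernel X A)

open UniformSpace

theorem inner_coe (f g : PreRKHM k) :
    inner A (f : RKHM k) (g : RKHM k) = PreRKHM.form k f g :=
  (Completion.isDenseInducing_coe.prodMap Completion.isDenseInducing_coe).extend_eq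
    (PreRKHM.continuous_inner k) (f, g)

theorem continuous_inner : Continuous fun p : RKHM k × RKHM k => inner A p.1 p.2 := by
  let inner' : PreRKHM k →+ PreRKHM k →+ A :=
    AddMonoidHom.mk' (fun f => AddMonoidHom.mk' (fun g => inner A f g)
      (fun g h => PreRKHM.form_add_right k f g h))
      (fun f g => AddMonoidHom.ext fun h => PreRKHM.form_add_left k f g h)
  have : Continuous fun p : PreRKHM k × PreRKHM k => inner' p.1 p.2 := PreRKHM.continuous_inner k
  exact (Completion.isDenseInducing_toCompl (PreRKHM k)).extend_Z_bilin
    (Completion.isDenseInducing_toCompl (PreRKHM k)) this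

theorem continuous_inner' {α : Type*} [TopologicalSpace α] {f g : α → RKHM k}
    (hf : Continuous f) (hg : Continuous g) : Continuous fun x => inner A (f x) (g x) :=
  (continuous_inner k).comp (hf.prodMk hg)

/-- `M_k` is a Hilbert `A`-module. -/
instance : HilbertCStarModule A (RKHM k) where
  inner_add_right u v w := by
    refine Completion.induction_on₃ u v w ?_ fun f g h => ?_
    · exact isClosed_eq
        (continuous_inner' k continuous_fst (continuous_snd.fst.add continuous_snd.snd))
        ((continuous_inner' k continuous_fst continuous_snd.fst).add
          (continuous_inner' k continuous_fst continuous_snd.snd))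
    · rw [← Completion.coe_add, inner_coe, inner_coe, inner_coe]
      exact PreRKHM.form_add_right k f g h
  inner_smul_right u v z := by
    refine Completion.induction_on₂ u v ?_ fun f g => ?_
    · exact isClosed_eq (continuous_inner' k continuous_fst (continuous_snd.const_smul z))
        ((continuous_inner' k continuous_fst continuous_snd).const_smul z)
    · rw [← Completion.coe_smul, inner_coe, inner_coe]
      exact PreRKHM.form_smul_right k f g z
  inner_op_smul_right u v c := by
    refine Completion.induction_on₂ u v ?_ fun f g => ?_
    · exact isClosed_eq
        (continuous_inner' k continuous_fst (continuous_snd.const_smul (MulOpposite.op c)))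
        ((continuous_inner' k continuous_fst continuous_snd).mul continuous_const)
    · rw [← Completion.coe_smul, inner_coe, inner_coe]
      exact PreRKHM.form_op_smul_right k f g c
  star_inner u v := by
    refine Completion.induction_on₂ u v ?_ fun f g => ?_
    · exact isClosed_eq (continuous_inner' k continuous_fst continuous_snd).star
        (continuous_inner' k continuous_snd continuous_fst)
    · rw [inner_coe, inner_coe]
      exact PreRKHM.star_form k f g
  inner_self_nonneg u := by
    refine Completion.induction_on u ?_ fun f => ?_
    · exact isClosed_le continuous_const (continuous_inner' k continuous_id continuous_id)
    · rw [inner_coe]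
      exact PreRKHM.form_self_nonneg k f
  inner_self_eq_zero u h := by
    have : ‖u‖ = √‖inner A u u‖ := by
      refine Completion.induction_on u ?_ fun f => ?_
      · exact isClosed_eq continuous_norm
          (continuous_inner' k continuous_id continuous_id).norm.sqrt
      · rw [inner_coe, Completion.norm_coe, PreRKHM.norm_def]
    rwa [h, norm_zero, Real.sqrt_zero, norm_eq_zero] at this
  norm_eq u := by
    refine Completion.induction_on u ?_ fun f => ?_
    · exact isClosed_eq continuous_norm
        (continuous_inner' k continuous_id continuous_id).norm.sqrt
    · rw [inner_coe, Completion.norm_coe, PreRKHM.norm_def]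
  complete := inferInstance

theorem coe_single (x : X) (c : A) :
    (Completion.coe' (show PreRKHM k from Finsupp.single x c) : RKHM k) =
      MulOpposite.op c • Completion.coe' (show PreRKHM k from Finsupp.single x 1) := by
  rw [← Completion.coe_smul]
  refine congrArg Completion.coe' ?_
  exact (show Finsupp.single x c = MulOpposite.op c • Finsupp.single x (1 : A) by
    rw [Finsupp.smul_single, op_smul_eq_mul, one_mul])

/-- The feature map `φ(x) = k(·, x)`. -/
def feature (x : X) : RKHM k :=
  Completion.coe' (show PreRKHM k from Finsupp.single x 1)

theorem inner_feature_feature (x y : X) : inner A (feature k x) (feature k y) = k x y := by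
  rw [feature, feature, inner_coe]
  refine (PreRKHM.form_single k _ x 1).trans ?_
  rw [Finsupp.sum_single_index (by simp)]
  simp

/-- A vector of `M_k` that is orthogonal to all `φ(x)` vanishes. -/
theorem eq_zero_of_inner_feature (v : RKHM k) (h : ∀ x, inner A (feature k x) v = 0) : v = 0 := by
  have h1 : ∀ f : X →₀ A, inner A (Completion.coe' (show PreRKHM k from f) : RKHM k) v = 0 := by
    intro f
    induction f using Finsupp.induction_linear with
    | zero =>
      have := HilbertCStarModule.inner_smul_left (A := A)
        (Completion.coe' (show PreRKHM k from 0) : RKHM k) v 0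
      rw [map_zero, zero_smul, zero_smul] at this
      exact this
    | add f g hf hg =>
      have := HilbertCStarModule.inner_add_left (A := A)
        (Completion.coe' (show PreRKHM k from f) : RKHM k)
        (Completion.coe' (show PreRKHM k from g)) v
      rw [hf, hg, add_zero, ← Completion.coe_add] at this
      exact this
    | single x c =>
      rw [coe_single, HilbertCStarModule.inner_op_smul_left]
      have := h x
      rw [feature] at this
      rw [this, mul_zero]
  refine HilbertCStarModule.inner_self_eq_zero (A := A) v ?_
  suffices ∀ u : RKHM k, inner A u v = 0 from this v
  intro u
  refine Completion.induction_on u ?_ fun f => h1 f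
  exact isClosed_eq (continuous_inner' k continuous_id continuous_const) continuous_const

/-- Elements of `M_k` are regarded as functions `X → A` through `v(x) = ⟨φ(x), v⟩`. -/
instance : FunLike (RKHM k) X A where
  coe v x := inner A (feature k x) v
  coe_injective u v h := by
    rw [← sub_eq_zero]
    refine eq_zero_of_inner_feature k _ fun x => ?_
    have h1 := HilbertCStarModule.inner_add_right (A := A) (feature k x) (u - v) v
    rw [sub_add_cancel] at h1
    have h2 : inner A (feature k x) u = inner A (feature k x) v := congrFun h x
    rw [h2] at h1
    exact right_eq_add.mp h1

/-- The reproducing property. -/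
theorem apply_eq_inner (v : RKHM k) (x : X) : v x = inner A (feature k x) v := rfl

theorem feature_apply (x y : X) : feature k x y = k y x := inner_feature_feature k y x

/-- The combination `∑ φ(x) c` is, as a function, `y ↦ ∑ k(y, x) c`. -/
theorem coe_apply (f : X →₀ A) (y : X) :
    (Completion.coe' (show PreRKHM k from f) : RKHM k) y = f.sum fun x c => k y x * c := by
  rw [apply_eq_inner, feature, inner_coe]
  refine (PreRKHM.form_single k f y 1).trans ?_
  rw [star_one, one_mul]

end RKHM

end RKHM

/-! ### `A`-valued measures and the kernel mean embedding -/

section KernelMeanEmbedding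

open MeasureTheory

/-- A finite regular `A`-valued measure: a countably additive `A`-valued map on the `σ`-algebra of
`X` which has finite total variation and is regular. -/
structure FiniteRegularMeasure (X A : Type*) [TopologicalSpace X] [MeasurableSpace X]
    [NormedAddCommGroup A] where
  toVectorMeasure : VectorMeasure X A
  finite : toVectorMeasure.variation Set.univ < ⊤
  regular : ∀ E : Set X, MeasurableSet E → ∀ ε : ℝ, 0 < ε →
    ∃ C G : Set X, IsCompact C ∧ C ⊆ E ∧ IsOpen G ∧ E ⊆ G ∧
      ∀ F : Set X, MeasurableSet F → F ⊆ G \ C → ‖toVectorMeasure F‖ ≤ ε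

variable {X A : Type*} [MeasurableSpace X] [CStarAlgebra A]

/-- The measure `μ*`, given by `μ*(E) = μ(E)*`. -/
def adjointMeasure (μ : VectorMeasure X A) : VectorMeasure X A :=
  μ.mapRange (starAddEquiv (R := A)).toAddMonoidHom continuous_star

theorem adjointMeasure_apply (μ : VectorMeasure X A) (E : Set X) :
    adjointMeasure μ E = star (μ E) := rfl

/-- The integral `∫ u(x) dμ(x)`, which is `∑ cᵢ μ(Eᵢ)` for a step function `u = ∑ cᵢ χ_{Eᵢ}`. -/
def integralLeft (u : X → A) (μ : VectorMeasure X A) : A :=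
  μ.integral u (ContinuousLinearMap.mul ℝ A)

/-- The integral `∫ dμ(x) u(x)`, which is `∑ μ(Eᵢ) cᵢ` for a step function `u = ∑ cᵢ χ_{Eᵢ}`. -/
def integralRight (μ : VectorMeasure X A) (u : X → A) : A :=
  μ.integral u (ContinuousLinearMap.mul ℝ A).flip

/-- The kernel mean embedding `∫ φ(x) dμ(x)` as a function on `X`, that is,
`y ↦ ∫ k(y, x) dμ(x)`. -/
def kernelMeanFunction [PartialOrder A] (k : PDKernel X A) (μ : VectorMeasure X A) : X → A :=
  fun y => integralLeft (fun x => k y x) μ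

end KernelMeanEmbedding

end

noncomputable section

/-! ### Weak limits of vectors in von Neumann modules. -/

section WeakLimits

open Filter Topology

/-! The embedding is obtained as the vector representing the functional `L v = ∫ dμ* v` on `M_k`.
The feature map `φ` is not assumed norm continuous, so `∫ φ dμ` is not formed as a norm limit; it is
a weak limit of Riemann sums, and the von Neumann module property is what makes such limits exist.

Elements of `M_k` are uniform limits of finite sums `∑ k(·, x) c`, hence bounded, continuous and
vanishing at infinity. Such functions are measurable for the σ-algebra generated by compact sets and
have totally bounded range, so they are integrable for any finite measure. Finitely many of them are
simultaneously approximated, uniformly, by `v ∘ s` with `s : X → X` simple. For `u = ∑ φ(x)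
μ(s⁻¹{x})` the reproducing property gives `⟨u, v⟩ = ∫ dμ* (v ∘ s)`, which is close to `L v`, while
`‖u‖ ≤ |μ|(X) √C` whatever `s` is (`RKHM.exists_norm_inner_sub_integralRight_le`).

It remains to represent a functional that is a pointwise limit of `⟨uᵢ, ·⟩` with `uᵢ` bounded
(`IsVonNeumannModule.exists_inner_eq_of_tendsto`). The adjoints of the operators `w ↦ uᵢ ⊗ w`
converge on elementary tensors, hence strongly by boundedness, to some `S`. So `S*` is a weak
operator limit of elements of the subspace `M_k` of operators; a biorthogonality argument puts it in
the strong closure, which is `M_k` itself. Faithfulness of `π` carries the identity back to `A`.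

Evaluating the representing vector at `y` means pairing it with `φ(y)`, which gives `∫ k(y, x)
dμ(x)`; the double integral formula is the case `v = Φ(ν)`. -/

theorem continuous_representation_apply {A W : Type*} [CStarAlgebra A]
    [NormedAddCommGroup W] [InnerProductSpace ℂ W] [CompleteSpace W]
    (π : A →⋆ₐ[ℂ] (W →L[ℂ] W)) (w : W) : Continuous fun a => π a w := by
  refine AddMonoidHomClass.continuous_of_bound
    ((AddMonoidHom.mk' (fun T : W →L[ℂ] W => T w) fun _ _ => rfl).comp (π : A →+ W →L[ℂ] W))
    ‖w‖ fun a => ?_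
  rw [mul_comm]
  exact ((π a).le_opNorm w).trans (by gcongr; exact NonUnitalStarAlgHom.norm_apply_le π a)

/-- A sequence indexed by finite sets and natural numbers whose elements satisfy a bound by
`1 / (n + 1)` at the members of the finite set converges pointwise. -/
theorem tendsto_finset_prod_nat {V E : Type*} [SeminormedAddCommGroup E] {f : Finset V × ℕ → V → E}
    {g : V → E} (h : ∀ p, ∀ v ∈ p.1, ‖f p v - g v‖ ≤ 1 / ((p.2 : ℝ) + 1)) (v : V) :
    Tendsto (fun p => f p v) atTop (𝓝 (g v)) := by
  rw [tendsto_iff_norm_sub_tendsto_zero]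
  have h0 : Tendsto (fun p : Finset V × ℕ => 1 / ((p.2 : ℝ) + 1)) atTop (𝓝 0) := by
    rw [← prod_atTop_atTop_eq]
    exact tendsto_one_div_add_atTop_nhds_zero_nat.comp tendsto_snd
  refine squeeze_zero' (Eventually.of_forall fun _ => norm_nonneg _) ?_ h0
  filter_upwards [eventually_ge_atTop (({v} : Finset V), 0)] with p hp
  exact h p v (hp.1 (Finset.mem_singleton_self v))

/-- Approximants chosen for each finite set and each error `1 / (n + 1)` form a net converging
strongly to `T`. -/
theorem PointwiseConvergenceCLM.mem_of_isClosed_of_approx {V E : Type*} [NormedAddCommGroup V]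
    [NormedSpace ℂ V] [NormedAddCommGroup E] [NormedSpace ℂ E] {s : Set (V →Lₚₜ[ℂ] E)}
    (hs : IsClosed s) (T : V →Lₚₜ[ℂ] E)
    (hT : ∀ (F : Finset V) (ε : ℝ), 0 < ε → ∃ R ∈ s, ∀ v ∈ F, ‖R v - T v‖ ≤ ε) : T ∈ s := by
  classical
  choose R hRs hR using fun p : Finset V × ℕ =>
    hT p.1 _ (Nat.one_div_pos_of_nat (n := p.2) (α := ℝ))
  refine hs.mem_of_tendsto (b := atTop) (f := R) ?_ (Eventually.of_forall hRs)
  exact PointwiseConvergenceCLM.tendsto_iff_forall_tendsto.mpr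
    (tendsto_finset_prod_nat (f := fun p v => R p v) hR)

variable {A W : Type*} [CStarAlgebra A] [PartialOrder A] [StarOrderedRing A]
  [NormedAddCommGroup W] [InnerProductSpace ℂ W] [CompleteSpace W]
  (π : A →⋆ₐ[ℂ] (W →L[ℂ] W))
  {M : Type*} [NormedAddCommGroup M] [NormedSpace ℂ M] [Module Aᵐᵒᵖ M] [HilbertCStarModule A M]

namespace InteriorTensor

theorem tmul_add_left (u v : M) (w : W) : tmul π (u + v) w = tmul π u w + tmul π v w := by
  rw [tmul, tmul, tmul, ← UniformSpace.Completion.coe_add]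
  exact congrArg _ (TensorProduct.add_tmul u v w)

theorem tmul_smul_left (z : ℂ) (v : M) (w : W) : tmul π (z • v) w = z • tmul π v w := by
  rw [tmul, tmul, ← UniformSpace.Completion.coe_smul]
  exact congrArg _ (TensorProduct.smul_tmul' z v w).symm

theorem norm_toOperator_le (v : M) : ‖toOperator π v‖ ≤ ‖v‖ :=
  LinearMap.mkContinuous_norm_le _ (norm_nonneg v) _

theorem adjoint_toOperator_tmul (u v : M) (w : W) :
    (toOperator π u).adjoint (tmul π v w) = π (inner A u v) w := by
  refine ext_inner_left ℂ fun h => ?_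
  rw [ContinuousLinearMap.adjoint_inner_right, toOperator_apply, inner_tmul]

/-- If the operators `w ↦ uᵢ ⊗ w` of a bounded family have adjoints converging weakly on elementary
tensors, the adjoints converge strongly to a bounded operator. -/
theorem exists_tendsto_adjoint {ι : Type*} {l : Filter ι} [l.NeBot] {u : ι → M} {C : ℝ}
    (hu : ∀ i, ‖u i‖ ≤ C) {L : M → A} (hL : ∀ v, Tendsto (fun i => inner A (u i) v) l (𝓝 (L v))) :
    ∃ S : InteriorTensor π M →L[ℂ] W,
      ∀ h, Tendsto (fun i => (toOperator π (u i)).adjoint h) l (𝓝 (S h)) := by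
  have hop : ∀ i h, ‖(toOperator π (u i)).adjoint h‖ ≤ C * ‖h‖ := fun i h => by
    refine (ContinuousLinearMap.le_opNorm _ _).trans ?_
    gcongr
    rw [LinearIsometryEquiv.norm_map]
    exact (norm_toOperator_le π _).trans (hu i)
  have h1 : ∀ t : InteriorTensorPre π M, ∃ y : W,
      Tendsto (fun i => (toOperator π (u i)).adjoint (t : InteriorTensor π M)) l (𝓝 y) := by
    intro t
    induction t using TensorProduct.induction_on with
    | zero =>
      refine ⟨0, ?_⟩
      have : ((0 : InteriorTensorPre π M) : InteriorTensor π M) = 0 :=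
        UniformSpace.Completion.coe_zero
      erw [this]
      simp only [map_zero]
      exact tendsto_const_nhds
    | tmul v w =>
      refine ⟨π (L v) w, ?_⟩
      change Tendsto (fun i => (toOperator π (u i)).adjoint (tmul π v w)) l _
      simp only [adjoint_toOperator_tmul]
      exact ((continuous_representation_apply π w).tendsto _).comp (hL v)
    | add s t hs ht =>
      obtain ⟨y, hy⟩ := hs
      obtain ⟨z, hz⟩ := ht
      refine ⟨y + z, ?_⟩
      have : ((show InteriorTensorPre π M from s + t) : InteriorTensor π M) =
          ((show InteriorTensorPre π M from s) : InteriorTensor π M) +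
          ((show InteriorTensorPre π M from t) : InteriorTensor π M) :=
        UniformSpace.Completion.coe_add _ _
      erw [this]
      simp only [map_add]
      exact hy.add hz
  choose S₀ hS₀ using h1
  let e : InteriorTensorPre π M →ₗ[ℂ] InteriorTensor π M :=
    (UniformSpace.Completion.toComplL (𝕜 := ℂ) (E := InteriorTensorPre π M)).toLinearMap
  let S₁ : InteriorTensorPre π M →ₗ[ℂ] W :=
    linearMapOfTendsto (l := l) S₀ (fun i => (toOperator π (u i)).adjoint.toLinearMap ∘ₗ e)
      (tendsto_pi_nhds.mpr hS₀)
  have hde : DenseRange e := UniformSpace.Completion.denseRange_coe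
  have hb : ∀ t, ‖S₁ t‖ ≤ C * ‖e t‖ := fun t =>
    le_of_tendsto (hS₀ t).norm (Eventually.of_forall fun i => hop i _)
  refine ⟨S₁.extendOfNorm e, ?_⟩
  -- The adjoints are uniformly Lipschitz, so the set of points where they converge to the extension
  -- is closed; it contains the dense algebraic tensor product.
  have heq : Equicontinuous fun i h => (toOperator π (u i)).adjoint h := by
    refine (LipschitzWith.uniformEquicontinuous _ (Real.toNNReal C) fun i => ?_).equicontinuous
    refine LipschitzWith.of_dist_le_mul fun x y => ?_
    rw [dist_eq_norm, dist_eq_norm, ← map_sub]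
    exact (hop i _).trans (by gcongr; exact Real.le_coe_toNNReal C)
  have hcl := heq.isClosed_setOfPred_tendsto (l := l) (S₁.extendOfNorm e).continuous
  intro h
  refine hde.induction_on (p := fun h => Tendsto (fun i => (toOperator π (u i)).adjoint h) l
    (𝓝 (S₁.extendOfNorm e h))) h hcl fun t => ?_
  rw [LinearMap.extendOfNorm_eq hde ⟨C, hb⟩]
  exact hS₀ t

/-- An operator whose adjoint is a weak limit of adjoints of operators `w ↦ uᵢ ⊗ w` is approximated
by operators `w ↦ v ⊗ w` in the strong operator topology. -/
theorem exists_norm_adjoint_sub_lt {ι : Type*} {l : Filter ι} [l.NeBot] {u : ι → M}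
    {S : InteriorTensor π M →L[ℂ] W}
    (hS : ∀ h, Tendsto (fun i => (toOperator π (u i)).adjoint h) l (𝓝 (S h)))
    (F : Finset W) {ε : ℝ} (hε : 0 < ε) :
    ∃ v : M, ∀ w ∈ F, ‖S.adjoint w - toOperator π v w‖ < ε := by
  -- One `v` has to serve all `w ∈ F` at once, so the tuples `(v ⊗ w)_w` are placed in a finite
  -- Hilbert sum, where they form a subspace.
  let R : M →ₗ[ℂ] PiLp 2 fun _ : F => InteriorTensor π M :=
    { toFun := fun v => WithLp.toLp 2 fun w => toOperator π v w
      map_add' := fun u v => by ext w; exact tmul_add_left π u v w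
      map_smul' := fun z v => by ext w; exact tmul_smul_left π z v w }
  have hmem : (WithLp.toLp 2 fun w : F => S.adjoint w : PiLp 2 fun _ : F => InteriorTensor π M) ∈
      R.range.topologicalClosure := by
    -- A tuple `z` orthogonal to every `(v ⊗ w)_w` is orthogonal to those of the `uᵢ`; moving the
    -- adjoint across and passing to the limit makes it orthogonal to `(S* w)_w`.
    rw [← Submodule.orthogonal_orthogonal_eq_closure, Submodule.mem_orthogonal]
    intro z hz
    rw [Submodule.mem_orthogonal'] at hz
    have h0 : ∀ v : M, ∑ w : F, ⟪z w, toOperator π v w⟫_ℂ = 0 := fun v => by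
      have := hz (R v) ⟨v, rfl⟩
      rwa [PiLp.inner_apply] at this
    rw [PiLp.inner_apply]
    have ht : Tendsto (fun i => ∑ w : F, ⟪(toOperator π (u i)).adjoint (z w), (w : W)⟫_ℂ) l
        (𝓝 (∑ w : F, ⟪S (z w), (w : W)⟫_ℂ)) :=
      tendsto_finsetSum _ fun w _ => (hS (z w)).inner tendsto_const_nhds
    simp only [ContinuousLinearMap.adjoint_inner_left, h0] at ht
    simpa only [ContinuousLinearMap.adjoint_inner_right] using
      tendsto_nhds_unique ht tendsto_const_nhds
  obtain ⟨_, ⟨v, rfl⟩, hv⟩ := Metric.mem_closure_iff.mp hmem ε hε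
  refine ⟨v, fun w hw => ?_⟩
  rw [dist_eq_norm] at hv
  exact (PiLp.norm_apply_le _ (⟨w, hw⟩ : F)).trans_lt hv

end InteriorTensor

/-- In a von Neumann module, a functional which is a pointwise limit of the functionals
`v ↦ ⟨uᵢ, v⟩` of a bounded family is given by a vector. -/
theorem IsVonNeumannModule.exists_inner_eq_of_tendsto {π : A →⋆ₐ[ℂ] (W →L[ℂ] W)}
    (hπ : Function.Injective π) (hM : IsVonNeumannModule π M)
    {ι : Type*} {l : Filter ι} [l.NeBot] {u : ι → M} {C : ℝ}
    (hu : ∀ i, ‖u i‖ ≤ C) {L : M → A} (hL : ∀ v, Tendsto (fun i => inner A (u i) v) l (𝓝 (L v))) :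
    ∃ u₀ : M, ∀ v, inner A u₀ v = L v := by
  obtain ⟨S, hS⟩ := InteriorTensor.exists_tendsto_adjoint π hu hL
  obtain ⟨u₀, hu₀⟩ := PointwiseConvergenceCLM.mem_of_isClosed_of_approx hM S.adjoint
    fun F ε hε => by
      obtain ⟨a, ha⟩ := InteriorTensor.exists_norm_adjoint_sub_lt π hS F hε
      refine ⟨InteriorTensor.toOperator π a, ⟨a, fun w => rfl⟩, fun w hw => ?_⟩
      rw [norm_sub_rev]
      exact (ha w hw).le
  refine ⟨u₀, fun v => hπ (ContinuousLinearMap.ext fun w => ?_)⟩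
  have hadj : S = (InteriorTensor.toOperator π u₀).adjoint := by
    rw [← ContinuousLinearMap.adjoint_adjoint S]
    exact congrArg _ (ContinuousLinearMap.ext hu₀)
  -- Both `π ⟨u₀, v⟩ w = S (v ⊗ w)` and `π (L v) w` are limits of `π ⟨uᵢ, v⟩ w`.
  rw [← InteriorTensor.adjoint_toOperator_tmul, ← hadj]
  refine tendsto_nhds_unique (hS _) ?_
  simp only [InteriorTensor.adjoint_toOperator_tmul]
  exact ((continuous_representation_apply π w).tendsto _).comp (hL v)

/-- In a von Neumann module, a functional which can be approximated on finite sets by the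
functionals `v ↦ ⟨u, v⟩` with `u` in a fixed ball is given by a vector. -/
theorem IsVonNeumannModule.exists_inner_eq {π : A →⋆ₐ[ℂ] (W →L[ℂ] W)}
    (hπ : Function.Injective π) (hM : IsVonNeumannModule π M) {C : ℝ} {L : M → A}
    (hL : ∀ (F : Finset M) (ε : ℝ), 0 < ε →
      ∃ u : M, ‖u‖ ≤ C ∧ ∀ v ∈ F, ‖inner A u v - L v‖ ≤ ε) :
    ∃ u₀ : M, ∀ v, inner A u₀ v = L v := by
  classical
  choose u hu huL using fun p : Finset M × ℕ =>
    hL p.1 _ (Nat.one_div_pos_of_nat (n := p.2) (α := ℝ))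
  exact hM.exists_inner_eq_of_tendsto hπ (l := atTop) hu
    (tendsto_finset_prod_nat (f := fun p v => inner A (u p) v) huL)

end WeakLimits

/-! ### Measurability and simple approximation of functions vanishing at infinity. -/

section ZeroAtInfinity

open Filter Topology MeasureTheory

variable {X E : Type*} [TopologicalSpace X] [NormedAddCommGroup E] {f : X → E}

theorem isCompact_preimage_of_tendsto_cocompact (hf : Continuous f)
    (hf0 : Tendsto f (cocompact X) (𝓝 0)) {F : Set E} (hF : IsClosed F) (h0 : (0 : E) ∉ F) :
    IsCompact (f ⁻¹' F) := by
  obtain ⟨K, hK, hKF⟩ := mem_cocompact.mp (hf0 (hF.isOpen_compl.mem_nhds h0))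
  refine hK.of_isClosed_subset (hF.preimage hf) fun x hx => ?_
  by_contra hxK
  exact hKF hxK hx

/-- Only compact sets are known to be measurable, and open sets of `X` need not be. Preimages of
closed sets avoiding `0` are compact, and these suffice to reach every open set. -/
theorem measurable_of_tendsto_cocompact [MeasurableSpace X] [MeasurableSpace E] [BorelSpace E]
    (hX : ∀ K : Set X, IsCompact K → MeasurableSet K) (hf : Continuous f)
    (hf0 : Tendsto f (cocompact X) (𝓝 0)) : Measurable f := by
  have hcl : ∀ F : Set E, IsClosed F → (0 : E) ∉ F → MeasurableSet (f ⁻¹' F) := fun F hF h0 =>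
    hX _ (isCompact_preimage_of_tendsto_cocompact hf hf0 hF h0)
  refine measurable_of_isOpen fun U hU => ?_
  by_cases h0 : (0 : E) ∈ U
  · exact (hcl Uᶜ hU.isClosed_compl fun h => h h0).of_compl
  -- An open set of a metric space is a countable union of closed sets, and here these all avoid
  -- `0`.
  · obtain ⟨F, hF, hFU, hFe, -⟩ := hU.exists_iUnion_isClosed
    rw [← hFe, Set.preimage_iUnion]
    exact MeasurableSet.iUnion fun n => hcl _ (hF n) fun h => h0 (hFU n h)

/-- Outside a compact set all values lie in one ball around `0`, and the image of the compact set is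
totally bounded. This yields the separability needed for strong measurability and the finite net
behind simple approximation. -/
theorem totallyBounded_range_of_tendsto_cocompact (hf : Continuous f)
    (hf0 : Tendsto f (cocompact X) (𝓝 0)) : TotallyBounded (Set.range f) := by
  refine Metric.totallyBounded_iff.mpr fun ε hε => ?_
  obtain ⟨K, hK, hKε⟩ := mem_cocompact.mp (hf0 (Metric.ball_mem_nhds 0 hε))
  obtain ⟨t, ht, htK⟩ := Metric.totallyBounded_iff.mp (hK.image hf).totallyBounded ε hε
  refine ⟨insert 0 t, ht.insert 0, ?_⟩
  rintro _ ⟨x, rfl⟩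
  rw [Set.biUnion_insert]
  by_cases hx : x ∈ K
  · exact Or.inr (htK ⟨x, hx, rfl⟩)
  · exact Or.inl (hKε hx)

theorem stronglyMeasurable_of_tendsto_cocompact [MeasurableSpace X]
    (hX : ∀ K : Set X, IsCompact K → MeasurableSet K) (hf : Continuous f)
    (hf0 : Tendsto f (cocompact X) (𝓝 0)) : StronglyMeasurable f := by
  borelize E
  exact stronglyMeasurable_iff_measurable_separable.mpr
    ⟨measurable_of_tendsto_cocompact hX hf hf0,
      (totallyBounded_range_of_tendsto_cocompact hf hf0).isSeparable⟩

/-- A function vanishing at infinity is uniformly approximated by its compositions with simple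
functions from the space to itself. -/
theorem exists_simpleFunc_norm_sub_comp_le [MeasurableSpace X]
    (hX : ∀ K : Set X, IsCompact K → MeasurableSet K) (hf : Continuous f)
    (hf0 : Tendsto f (cocompact X) (𝓝 0)) {ε : ℝ} (hε : 0 < ε) :
    ∃ s : SimpleFunc X X, ∀ x, ‖f (s x) - f x‖ ≤ ε := by
  rcases isEmpty_or_nonempty X with hXe | ⟨⟨x₀⟩⟩
  · exact ⟨SimpleFunc.ofIsEmpty, fun x => isEmptyElim x⟩
  borelize E
  -- The centres of the net are taken in the range of `f`, so that each is `f z` for a point `z`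
  -- which can serve as a value of `s`.
  obtain ⟨t, htr, ht, hcov⟩ := (totallyBounded_range_of_tendsto_cocompact hf hf0).exists_subset
    (Metric.dist_mem_uniformity hε)
  -- Induction on the net: on the preimage of the ball around a new centre `f z`, the value of `s`
  -- is reset to `z`.
  have key : ∀ t : Set E, t.Finite → t ⊆ Set.range f → ∃ s : SimpleFunc X X,
      ∀ x, (∃ y ∈ t, dist (f x) y < ε) → dist (f x) (f (s x)) < ε := by
    intro t ht
    induction t, ht using Set.Finite.induction_on with
    | empty => exact fun _ => ⟨SimpleFunc.const X x₀, fun x hx => by simp at hx⟩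
    | @insert a t _ _ ih =>
      intro htr
      obtain ⟨s, hs⟩ := ih ((Set.subset_insert a t).trans htr)
      obtain ⟨z, rfl⟩ := htr (Set.mem_insert a t)
      classical
      refine ⟨SimpleFunc.piecewise (f ⁻¹' Metric.ball (f z) ε)
        (measurable_of_tendsto_cocompact hX hf hf0 Metric.isOpen_ball.measurableSet)
        (SimpleFunc.const X z) s, fun x hx => ?_⟩
      rw [SimpleFunc.piecewise_apply]
      split_ifs with h
      · exact h
      · obtain ⟨y, rfl | hy, hxy⟩ := hx
        · exact absurd hxy h
        · exact hs x ⟨y, hy, hxy⟩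
  obtain ⟨s, hs⟩ := key t ht htr
  refine ⟨s, fun x => ?_⟩
  rw [norm_sub_rev, ← dist_eq_norm]
  obtain ⟨y, hy, hxy⟩ := Set.mem_iUnion₂.mp (hcov ⟨x, rfl⟩)
  exact (hs x ⟨y, hy, hxy⟩).le

end ZeroAtInfinity

/-! ### Integrals of simple functions, and the adjoint measure. -/

section Measures

open Filter Topology MeasureTheory

variable {X : Type*} [MeasurableSpace X]

theorem MeasureTheory.VectorMeasure.integral_simpleFunc_comp {Y E F G : Type*}
    [NormedAddCommGroup E] [NormedSpace ℝ E] [NormedAddCommGroup F] [NormedSpace ℝ F]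
    [NormedAddCommGroup G] [NormedSpace ℝ G] [CompleteSpace G] (μ : VectorMeasure X F)
    [IsFiniteMeasure μ.variation] (B : E →L[ℝ] F →L[ℝ] G) (s : SimpleFunc X Y) (g : Y → E) :
    μ.integral (fun x => g (s x)) B = ∑ y ∈ s.range, B (g y) (μ (s ⁻¹' {y})) := by
  classical
  have h : (fun x => g (s x)) =
      fun x => ∑ y ∈ s.range, (s ⁻¹' {y}).indicator (fun _ => g y) x := by
    ext x
    rw [Finset.sum_eq_single_of_mem (s x) (s.mem_range_self x)]
    · simp
    · intro y _ hy
      exact Set.indicator_of_notMem (fun hx => hy hx.symm) _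
  rw [h, VectorMeasure.integral_finsetSum]
  · exact Finset.sum_congr rfl fun y _ =>
      VectorMeasure.integral_indicator_const (g y) (s.measurableSet_fiber y)
  · exact fun y _ => (integrable_const (g y)).indicator (s.measurableSet_fiber y)

/-- The fibres of `s` partition the space. This bounds the norms of the Riemann sums independently
of the partition. -/
theorem MeasureTheory.VectorMeasure.sum_norm_fiber_le {Y F : Type*} [NormedAddCommGroup F]
    (μ : VectorMeasure X F) [IsFiniteMeasure μ.variation] (s : SimpleFunc X Y) :
    ∑ y ∈ s.range, ‖μ (s ⁻¹' {y})‖ ≤ μ.variation.real Set.univ := by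
  calc ∑ y ∈ s.range, ‖μ (s ⁻¹' {y})‖
      ≤ ∑ y ∈ s.range, (μ.variation (s ⁻¹' {y})).toReal :=
        Finset.sum_le_sum fun y _ => VectorMeasure.norm_measure_le_variation
    _ = μ.variation.real Set.univ := by
        rw [← ENNReal.toReal_sum fun _ _ => measure_ne_top _ _,
          s.sum_range_measure_preimage_singleton, Measure.real]

variable {A : Type*} [CStarAlgebra A]

theorem variation_adjointMeasure (μ : VectorMeasure X A) :
    (adjointMeasure μ).variation = μ.variation := by
  have h : ∀ ν : VectorMeasure X A, (adjointMeasure ν).variation ≤ ν.variation := fun ν =>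
    VectorMeasure.variation_le_of_forall_enorm_le fun E _ => by
      rw [adjointMeasure_apply, ← ofReal_norm, norm_star, ofReal_norm]
      exact ν.enorm_measure_le_variation E
  refine le_antisymm (h μ) ?_
  have := h (adjointMeasure μ)
  rwa [show adjointMeasure (adjointMeasure μ) = μ from
    VectorMeasure.ext fun E _ => star_star (μ E)] at this

/-- On step functions this is `(μ(E)* c)* = c* μ(E)`. In general the star is moved inside both
integrals, leaving two integrals of `v` with the same bilinear integrand. -/
theorem star_integralRight_adjointMeasure (μ : VectorMeasure X A) {v : X → A}
    (hv : μ.Integrable v) :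
    star (integralRight (adjointMeasure μ) v) = integralLeft (fun x => star (v x)) μ := by
  have h1 := VectorMeasure.continuousLinearMap_apply_integral (μ := adjointMeasure μ) (f := v)
    (B := (ContinuousLinearMap.mul ℝ A).flip) (C := (starL' ℝ : A ≃L[ℝ] A).toContinuousLinearMap)
    (by rwa [variation_adjointMeasure])
  have h2 := VectorMeasure.integral_continuousLinearMap_comp (μ := μ) (f := v)
    (B := ContinuousLinearMap.mul ℝ A) (C := (starL' ℝ : A ≃L[ℝ] A).toContinuousLinearMap) hv
  refine h1.trans (Eq.trans ?_ h2.symm)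
  -- The integrals are built over the variations of `μ*` and of `μ`, which are equal only
  -- propositionally, and carry proofs depending on them; generalizing everything allows
  -- substitution.
  have key : ∀ (m₁ m₂ : Measure X) (T₁ T₂ : Set X → A →L[ℝ] A) (C₁ C₂ : ℝ)
      (hT₁ : DominatedFinMeasAdditive m₁ T₁ C₁) (hT₂ : DominatedFinMeasAdditive m₂ T₂ C₂),
      m₁ = m₂ → T₁ = T₂ → setToFun m₁ T₁ hT₁ v = setToFun m₂ T₂ hT₂ v := by
    rintro m₁ _ T₁ _ C₁ C₂ hT₁ hT₂ rfl rfl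
    rfl
  refine key _ _ _ _ _ _ _ _ (variation_adjointMeasure μ) ?_
  ext E a
  exact (star_mul (star (μ E)) a).trans (by rw [star_star]; rfl)

end Measures

/-! ### Elements of the reproducing kernel module as functions vanishing at infinity. -/

section Module

namespace HilbertCStarModule

variable {A M : Type*} [CStarAlgebra A] [PartialOrder A]
  [NormedAddCommGroup M] [NormedSpace ℂ M] [Module Aᵐᵒᵖ M] [HilbertCStarModule A M]

theorem norm_op_smul_le (c : A) (v : M) : ‖MulOpposite.op c • v‖ ≤ ‖c‖ * ‖v‖ := by
  rw [norm_eq (A := A), norm_eq (A := A) v, inner_op_smul_left, inner_op_smul_right]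
  refine Real.sqrt_le_iff.mpr ⟨by positivity, ?_⟩
  rw [mul_pow, Real.sq_sqrt (norm_nonneg _)]
  calc ‖star c * (inner A v v * c)‖ ≤ ‖star c‖ * (‖inner A v v‖ * ‖c‖) :=
        (norm_mul_le _ _).trans (by gcongr; exact norm_mul_le _ _)
    _ = ‖c‖ ^ 2 * ‖inner A v v‖ := by rw [norm_star]; ring

end HilbertCStarModule

namespace RKHM

open UniformSpace Filter Topology

variable {X A : Type*} [CStarAlgebra A] [PartialOrder A] [StarOrderedRing A] {k : PDKernel X A}

theorem norm_inner_le (u v : RKHM k) : ‖inner A u v‖ ≤ ‖u‖ * ‖v‖ := by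
  refine Completion.induction_on₂ u v ?_ fun f g => ?_
  · exact isClosed_le (continuous_inner' k continuous_fst continuous_snd).norm
      (continuous_fst.norm.mul continuous_snd.norm)
  · rw [inner_coe, Completion.norm_coe, Completion.norm_coe, PreRKHM.norm_def, PreRKHM.norm_def]
    exact PreRKHM.norm_form_le k f g

theorem norm_feature_le {C : ℝ} (hC : ∀ x y, ‖k x y‖ ≤ C) (x : X) : ‖feature k x‖ ≤ √C := by
  rw [HilbertCStarModule.norm_eq (A := A), inner_feature_feature]
  exact Real.sqrt_le_sqrt (hC x x)

theorem norm_apply_le {C : ℝ} (hC : ∀ x y, ‖k x y‖ ≤ C) (v : RKHM k) (x : X) :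
    ‖v x‖ ≤ √C * ‖v‖ :=
  (norm_inner_le _ _).trans (by gcongr; exact norm_feature_le hC x)

theorem sub_apply (u v : RKHM k) (x : X) : (u - v) x = u x - v x := by
  rw [eq_sub_iff_add_eq]
  have := HilbertCStarModule.inner_add_right (A := A) (feature k x) (u - v) v
  rw [sub_add_cancel] at this
  exact this.symm

variable [TopologicalSpace X]

/-- A bounded kernel makes the norm of `M_k` dominate the sup norm up to `√C`, so density in norm
becomes uniform approximation. Continuity and vanishing at infinity then pass from finite sums to
all of `M_k`. -/
theorem exists_coe_norm_apply_sub_lt (hk : k.IsC0) (v : RKHM k) {ε : ℝ} (hε : 0 < ε) :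
    ∃ f : PreRKHM k, ∀ x, ‖v x - (f : RKHM k) x‖ < ε := by
  obtain ⟨C, hC⟩ := hk.bounded
  obtain ⟨_, ⟨f, rfl⟩, hf⟩ := Metric.mem_closure_iff.mp
    -- The `+ 1` keeps the denominator positive when `√C = 0`.
    (Completion.denseRange_coe (α := PreRKHM k) v) (ε / (√C + 1)) (by positivity)
  refine ⟨f, fun x => ?_⟩
  rw [dist_eq_norm, lt_div_iff₀ (by positivity)] at hf
  rw [← sub_apply]
  refine (norm_apply_le hC _ x).trans_lt (lt_of_le_of_lt ?_ hf)
  rw [mul_comm]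
  gcongr
  linarith

theorem continuous_coe (hk : k.IsC0) (v : RKHM k) : Continuous (v : X → A) := by
  refine continuous_of_uniform_approx_of_continuous fun U hU => ?_
  obtain ⟨ε, hε, hU⟩ := Metric.mem_uniformity_dist.mp hU
  obtain ⟨f, hf⟩ := exists_coe_norm_apply_sub_lt hk v hε
  refine ⟨_, ?_, fun x => hU (by rw [dist_eq_norm]; exact hf x)⟩
  rw [show ((f : RKHM k) : X → A) = _ from funext (coe_apply k f)]
  exact continuous_finsetSum _ fun x _ => (hk.continuous x).mul continuous_const

theorem tendsto_cocompact (hk : k.IsC0) (v : RKHM k) :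
    Tendsto (v : X → A) (cocompact X) (𝓝 0) := by
  rw [Metric.tendsto_nhds]
  intro ε hε
  obtain ⟨f, hf⟩ := exists_coe_norm_apply_sub_lt hk v (half_pos hε)
  have hf0 : Tendsto ((f : RKHM k) : X → A) (cocompact X) (𝓝 0) := by
    have h : ((f : RKHM k) : X → A) =
        fun y => ∑ x ∈ Finsupp.support f, k y x * (show X →₀ A from f) x :=
      funext fun y => coe_apply k f y
    rw [h]
    simpa using tendsto_finsetSum (Finsupp.support f) fun x _ =>
      (hk.zero_at_infty x).mul_const ((show X →₀ A from f) x)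
  filter_upwards [Metric.tendsto_nhds.mp hf0 _ (half_pos hε)] with x hx
  have h1 := dist_triangle (v x) ((f : RKHM k) x) 0
  have h2 := hf x
  rw [← dist_eq_norm] at h2
  linarith

end RKHM

end Module

/-! ### The kernel mean embedding as a representing vector. -/

section KernelMean

open Filter Topology MeasureTheory

variable {X A : Type*} [TopologicalSpace X] [MeasurableSpace X] [CStarAlgebra A] [PartialOrder A]
  [StarOrderedRing A] {k : PDKernel X A}

namespace RKHM

theorem integrable_coe (hX : ∀ K : Set X, IsCompact K → MeasurableSet K) (hk : k.IsC0)
    (v : RKHM k) (m : Measure X) [IsFiniteMeasure m] : Integrable (v : X → A) m := by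
  obtain ⟨C, hC⟩ := hk.bounded
  exact Integrable.of_bound (stronglyMeasurable_of_tendsto_cocompact hX (continuous_coe hk v)
    (tendsto_cocompact hk v)).aestronglyMeasurable (√C * ‖v‖)
    (Eventually.of_forall fun x => norm_apply_le hC v x)

/-- The functional `v ↦ ∫ dμ* v` is approximated on finite sets by inner products with vectors
`∑ φ(x) μ(E)` of bounded norm. -/
theorem exists_norm_inner_sub_integralRight_le
    (hX : ∀ K : Set X, IsCompact K → MeasurableSet K) (hk : k.IsC0) {C : ℝ}
    (hC : ∀ x y, ‖k x y‖ ≤ C) (μ : VectorMeasure X A) [IsFiniteMeasure μ.variation]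
    (F : Finset (RKHM k)) {ε : ℝ} (hε : 0 < ε) :
    ∃ u : RKHM k, ‖u‖ ≤ μ.variation.real Set.univ * √C ∧
      ∀ v ∈ F, ‖inner A u v - integralRight (adjointMeasure μ) v‖ ≤ ε := by
  have : IsFiniteMeasure (adjointMeasure μ).variation := by
    rwa [variation_adjointMeasure]
  set B : A →L[ℝ] A →L[ℝ] A := (ContinuousLinearMap.mul ℝ A).flip
  set R : ℝ := ‖B‖ * (adjointMeasure μ).variation.real Set.univ
  have hR : 0 ≤ R := by positivity
  -- The finitely many `v` are bundled into one function with values in `F → A`, so that a single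
  -- `s` works for all of them.
  obtain ⟨s, hs⟩ := exists_simpleFunc_norm_sub_comp_le hX
    (f := fun x => fun v : F => (v : RKHM k) x)
    (continuous_pi fun v => continuous_coe hk v)
    (tendsto_pi_nhds.mpr fun v => tendsto_cocompact hk v.1)
    (ε := ε / (R + 1)) (by positivity)
  refine ⟨∑ x ∈ s.range, MulOpposite.op (μ (s ⁻¹' {x})) • feature k x, ?_, fun v hv => ?_⟩
  · calc ‖∑ x ∈ s.range, MulOpposite.op (μ (s ⁻¹' {x})) • feature k x‖
        ≤ ∑ x ∈ s.range, ‖μ (s ⁻¹' {x})‖ * √C := norm_sum_le_of_le _ fun x _ =>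
          (HilbertCStarModule.norm_op_smul_le _ _).trans (by gcongr; exact norm_feature_le hC x)
      _ ≤ μ.variation.real Set.univ * √C := by
          rw [← Finset.sum_mul]
          gcongr
          exact μ.sum_norm_fiber_le s
  -- By the reproducing property both sides are `∑ μ(s⁻¹{x})* v(x)`.
  · have h1 : inner A (∑ x ∈ s.range, MulOpposite.op (μ (s ⁻¹' {x})) • feature k x) v =
        (adjointMeasure μ).integral (fun x => v (s x)) B := by
      rw [VectorMeasure.integral_simpleFunc_comp, HilbertCStarModule.inner_sum_left]
      exact Finset.sum_congr rfl fun x _ => HilbertCStarModule.inner_op_smul_left _ _ _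
    have hvi := integrable_coe hX hk v (adjointMeasure μ).variation
    have hsi : Integrable (fun x => v (s x)) (adjointMeasure μ).variation :=
      (s.map v).integrable_of_isFiniteMeasure
    rw [h1, integralRight, ← VectorMeasure.integral_sub hsi hvi]
    refine (VectorMeasure.norm_integral_le_of_norm_le_const (C := ε / (R + 1))
      (Eventually.of_forall fun x => ?_)).trans ?_
    · exact (norm_le_pi_norm _ (⟨v, hv⟩ : F)).trans (hs x)
    · rw [mul_assoc, div_mul_eq_mul_div, div_le_iff₀ (by positivity)]
      gcongr
      linarith

/-- The functional `v ↦ ∫ dμ* v` on a reproducing kernel Hilbert module which is a von Neumann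
module is given by the kernel mean embedding of `μ`. -/
theorem exists_eq_kernelMeanFunction {W : Type*} [NormedAddCommGroup W] [InnerProductSpace ℂ W]
    [CompleteSpace W] {π : A →⋆ₐ[ℂ] (W →L[ℂ] W)} (hπ : Function.Injective π)
    (hM : IsVonNeumannModule π (RKHM k))
    (hX : ∀ K : Set X, IsCompact K → MeasurableSet K) (hk : k.IsC0)
    (μ : VectorMeasure X A) [IsFiniteMeasure μ.variation] :
    ∃ u : RKHM k, (u : X → A) = kernelMeanFunction k μ ∧
      ∀ v : RKHM k, inner A u v = integralRight (adjointMeasure μ) v := by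
  obtain ⟨C, hC⟩ := hk.bounded
  obtain ⟨u, hu⟩ := hM.exists_inner_eq hπ (L := fun v => integralRight (adjointMeasure μ) v)
    fun F ε hε => exists_norm_inner_sub_integralRight_le hX hk hC μ F hε
  refine ⟨u, funext fun y => ?_, hu⟩
  -- `u(y) = ⟨u, φ(y)⟩* = (∫ dμ*(x) k(x, y))* = ∫ k(x, y)* dμ(x)`, and `k(x, y)* = k(y, x)`.
  rw [apply_eq_inner, ← HilbertCStarModule.star_inner, hu,
    star_integralRight_adjointMeasure μ (integrable_coe hX hk _ _), kernelMeanFunction]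
  simp only [feature_apply, k.star_apply]

end RKHM

end KernelMean

end

/-- Well-definedness of the kernel mean embedding in reproducing kernel Hilbert C*-modules. -/
theorem mainTheorem2 {X A W : Type*}
    [TopologicalSpace X] [LocallyCompactSpace X] [T2Space X]
    [mX : MeasurableSpace X]
    (hX : mX = MeasurableSpace.generateFrom {C : Set X | IsCompact C})
    [CStarAlgebra A] [PartialOrder A] [StarOrderedRing A]
    [NormedAddCommGroup W] [InnerProductSpace ℂ W] [CompleteSpace W]
    (π : A →⋆ₐ[ℂ] (W →L[ℂ] W)) (hπ : IsVonNeumannRepresentation π)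
    (k : PDKernel X A) (hk : k.IsC0) (hM : IsVonNeumannModule π (RKHM k)) :
    ∃ Φ : FiniteRegularMeasure X A → RKHM k,
      (∀ μ : FiniteRegularMeasure X A,
        (∀ y : X, μ.toVectorMeasure.Integrable fun x => k y x) ∧
        (Φ μ : X → A) = kernelMeanFunction k μ.toVectorMeasure) ∧
      (∀ (μ : FiniteRegularMeasure X A) (v : RKHM k),
        (adjointMeasure μ.toVectorMeasure).Integrable (v : X → A) ∧
        inner A (Φ μ) v = integralRight (adjointMeasure μ.toVectorMeasure) v) ∧
      ∀ μ ν : FiniteRegularMeasure X A,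
        (adjointMeasure μ.toVectorMeasure).Integrable
          (fun x => integralLeft (fun y => k x y) ν.toVectorMeasure) ∧
        inner A (Φ μ) (Φ ν) =
          integralRight (adjointMeasure μ.toVectorMeasure)
            (fun x => integralLeft (fun y => k x y) ν.toVectorMeasure) := by
  have hXc : ∀ K : Set X, IsCompact K → MeasurableSet K := fun K hK => by
    rw [hX]
    exact MeasurableSpace.measurableSet_generateFrom hK
  have hfin : ∀ μ : FiniteRegularMeasure X A,
      MeasureTheory.IsFiniteMeasure μ.toVectorMeasure.variation := fun μ => ⟨μ.finite⟩
  have hfin' : ∀ μ : FiniteRegularMeasure X A,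
      MeasureTheory.IsFiniteMeasure (adjointMeasure μ.toVectorMeasure).variation := fun μ => by
    rw [variation_adjointMeasure]
    exact hfin μ
  choose Φ hΦ hΦi using fun μ : FiniteRegularMeasure X A =>
    RKHM.exists_eq_kernelMeanFunction hπ.1 hM hXc hk μ.toVectorMeasure
  have hint : ∀ (μ : FiniteRegularMeasure X A) (v : RKHM k),
      (adjointMeasure μ.toVectorMeasure).Integrable (v : X → A) := fun μ v =>
    RKHM.integrable_coe hXc hk v _
  refine ⟨Φ, fun μ => ⟨fun y => ?_, hΦ μ⟩, fun μ v => ⟨hint μ v, hΦi μ v⟩, fun μ ν => ?_⟩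
  -- The section `k(y, ·)` is the pointwise adjoint of the function `φ(y)`, which belongs to `M_k`.
  · have h := (starL' ℝ : A ≃L[ℝ] A).toContinuousLinearMap.integrable_comp
      (RKHM.integrable_coe hXc hk (RKHM.feature k y) μ.toVectorMeasure.variation)
    refine h.congr (Filter.Eventually.of_forall fun x => ?_)
    exact (congrArg star (RKHM.feature_apply k y x)).trans (k.star_apply y x)
  -- The inner integral, as a function of `x`, is `Φ(ν)`, so the case `v = Φ(ν)` applies.
  · change (adjointMeasure μ.toVectorMeasure).Integrable (kernelMeanFunction k ν.toVectorMeasure) ∧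
      _ = integralRight _ (kernelMeanFunction k ν.toVectorMeasure)
    rw [← hΦ ν]
    exact ⟨hint μ (Φ ν), hΦi μ (Φ ν)⟩
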